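/- Theorem 3. Let $\mathbb K=\mathbb R$ or $\mathbb C$. Consider the $2\times 2$ X channel: two single-antenna transmitters $i=1,2$, two single-antenna receivers $k=1,2$, and four independent messages $W_{ki}$, one from each transmitter $i$ to each receiver $k$. In time slot $t=0,1,2,\dots$ receiver $k$ observes $$y_k(t)=h_{k1}(t)\,x_1(t)+h_{k2}(t)\,x_2(t)+z_k(t),$$ where $z_k$ is white Gaussian noise (independent over time, with independent standard normal real components) independent of the channel and the messages. The fading is staggered block fading with coherence time $T=2$: the pair $(h_{k1},h_{k2})$ is constant on each coherence block of receiver $k$; the blocks of receiver 1 are $\{0\},\{1,2\},\{3,4\},\dots$, and those of receiver 2 are $\{0,1\},\{2,3\},\dots$. The channel states are generic: for each receiver the sequence of block states is stationary (not necessarily independent), and the four coefficients of two consecutive blocks have a joint density with respect to Lebesgue measure on $\mathbb K^4$. There is no CSIT and no transmitter cooperation: transmitter $i$ encodes only its own two messages $W_{1i},W_{2i}$, by a code that may depend on the channel statistics but not on the channel realization, and each of its codewords of length $n$ satisfies $\sum_{t<n}|x_i(t)|^2\le nP$. There is perfect CSIR: receiver $k$ knows its own channel coefficients over the whole block of $n$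 slots. Then a total of $\frac43$ degrees of freedom is achievable almost surely. That is, there are $d_{ki}\ge 0$ with $\sum_{k,i}d_{ki}=\frac43$, rates $R_{ki}(P)$ with $$\lim_{P\to\infty}\frac{R_{ki}(P)}{c\log P}=d_{ki},\qquad c=\tfrac12\text{ if }\mathbb K=\mathbb R,\quad c=1\text{ if }\mathbb K=\mathbb C,$$ and, for every $P>0$ and every block length $n$, a code as above such that for each $P$ and all large $n$ the message $W_{ki}$ takes at least $e^{nR_{ki}(P)}$ values, and such that for almost every channel realization there is a $P_0$ with the following property: for every $P\ge P_0$, the probability, conditional on that realization and with uniform messages, that receiver $k$ decodes its two messages incorrectly tends to $0$ as $n\to\infty$, for $k=1,2$. If, moreover, the block states of each receiver form an ergodic sequence (for example, if they are i.i.d.), then a total of $\frac43$ degrees of freedom is also achievable by such codes (with rates as above) in the sense that, for every $P>0$, these error probabilities tend to $0$ as $n\to\infty$ for almost every channel realization. -/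

import Mathlib

open MeasureTheory ProbabilityTheory Filter Topology

noncomputable section

namespace XChannel

/-! Conventions: time slots are `t = 0, 1, 2, …`; `k : Fin 2` is a receiver and `i : Fin 2` a
transmitter; the field `𝕜` is `ℝ` or `ℂ`. -/

/-- Staggered block fading with coherence time `2`: the index of the coherence block of receiver `k`
that contains time slot `t`. The blocks of receiver `0` are `{0}, {1, 2}, {3, 4}, …` (the first one
started before transmission), those of receiver `1` are `{0, 1}, {2, 3}, {4, 5}, …`. -/
def coherenceBlock (k : Fin 2) (t : ℕ) : ℕ :=
  if k = 0 then (t + 1) / 2 else t / 2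

/-- A fading process: `H b ω k i` is the coefficient from transmitter `i` to receiver `k` during the
`b`-th coherence block of receiver `k`. The realization `ω` over the first `n` slots, as seen by
receiver `k`: -/
def channelGain {𝕜 Ω : Type*} (H : ℕ → Ω → Fin 2 → Fin 2 → 𝕜) (ω : Ω) (n : ℕ) (k : Fin 2) :
    Fin n → Fin 2 → 𝕜 :=
  fun t i => H (coherenceBlock k t) ω k i

/-- Law of the sequence of coherence-block states `(h_1, h_2)(b)`, `b = 0, 1, …`, of receiver `k`. -/
def fadingLaw {𝕜 Ω : Type*} [RCLike 𝕜] [MeasurableSpace Ω] (μ : Measure Ω)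
    (H : ℕ → Ω → Fin 2 → Fin 2 → 𝕜) (k : Fin 2) : Measure (ℕ → Fin 2 → 𝕜) :=
  μ.map (fun ω b => H b ω k)

/-- The shift by one coherence block. -/
def blockShift {𝕜 : Type*} (s : ℕ → Fin 2 → 𝕜) : ℕ → Fin 2 → 𝕜 := fun b => s (b + 1)

/-- The fading seen by each receiver is stationary from one coherence block to the next. -/
def StationaryFading {𝕜 Ω : Type*} [RCLike 𝕜] [MeasurableSpace Ω] (μ : Measure Ω)
    (H : ℕ → Ω → Fin 2 → Fin 2 → 𝕜) : Prop :=
  ∀ k, MeasurePreserving blockShift (fadingLaw μ H k) (fadingLaw μ H k)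

/-- The fading seen by each receiver is stationary and ergodic. -/
def ErgodicFading {𝕜 Ω : Type*} [RCLike 𝕜] [MeasurableSpace Ω] (μ : Measure Ω)
    (H : ℕ → Ω → Fin 2 → Fin 2 → 𝕜) : Prop :=
  ∀ k, Ergodic blockShift (fadingLaw μ H k)

/-- Generic channel states: for each receiver, the four coefficients in two consecutive coherence
blocks have a joint density with respect to Lebesgue measure. No independence is required. -/
def GenericFading {𝕜 Ω : Type*} [RCLike 𝕜] [MeasurableSpace Ω] (μ : Measure Ω)
    (H : ℕ → Ω → Fin 2 → Fin 2 → 𝕜) : Prop :=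
  ∀ k b, μ.map (fun ω => (H b ω k, H (b + 1) ω k)) ≪ volume

/-- A block code of length `n` for the X channel with no CSIT and perfect CSIR. There are `M k i`
messages from transmitter `i` to receiver `k`. Transmitter `i` only uses its own two messages; the
codewords do not involve the channel coefficients. Receiver `k` decodes its two messages from its
channel coefficients and its received signal. -/
structure Code (𝕜 : Type*) [RCLike 𝕜] (n : ℕ) (M : Fin 2 → Fin 2 → ℕ) where
  enc : (i : Fin 2) → ((k : Fin 2) → Fin (M k i)) → Fin n → 𝕜
  dec : (k : Fin 2) → (Fin n → Fin 2 → 𝕜) → (Fin n → 𝕜) → ((i : Fin 2) → Fin (M k i))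
  measurable_dec : ∀ k, Measurable (Function.uncurry (dec k))

/-- White Gaussian noise over `n` slots, independent over time, with independent standard normal
real components in each slot (one if `𝕜 = ℝ`; real and imaginary part if `𝕜 = ℂ`). -/
def noise (𝕜 : Type*) [RCLike 𝕜] (n : ℕ) : Measure (Fin n → 𝕜) :=
  Measure.pi fun _ => stdGaussian 𝕜

/-- The four messages, `w k i` from transmitter `i` to receiver `k`. -/
abbrev Messages (M : Fin 2 → Fin 2 → ℕ) : Type := (k : Fin 2) → (i : Fin 2) → Fin (M k i)

/-- Signal received by a receiver with channel coefficients `g`, for messages `w` and noise `z`. -/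
def Code.received {𝕜 : Type*} [RCLike 𝕜] {n : ℕ} {M : Fin 2 → Fin 2 → ℕ} (C : Code 𝕜 n M)
    (g : Fin n → Fin 2 → 𝕜) (w : Messages M) (z : Fin n → 𝕜) : Fin n → 𝕜 :=
  fun t => (∑ i, g t i * C.enc i (fun k => w k i) t) + z t

/-- Probability, given its channel coefficients `g`, that receiver `k` errs in at least one of its
two messages, for independent and uniformly distributed messages. -/
def Code.errorProb {𝕜 : Type*} [RCLike 𝕜] {n : ℕ} {M : Fin 2 → Fin 2 → ℕ} (C : Code 𝕜 n M)
    (k : Fin 2) (g : Fin n → Fin 2 → 𝕜) : ℝ :=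
  (∑ w : Messages M, (noise 𝕜 n).real {z | C.dec k g (C.received g w z) ≠ w k}) /
    Fintype.card (Messages M)

/-- A choice of code for each transmit power `P` and block length `n`. -/
structure CodeFamily (𝕜 : Type*) [RCLike 𝕜] where
  M : ℝ → ℕ → Fin 2 → Fin 2 → ℕ
  code : (P : ℝ) → (n : ℕ) → Code 𝕜 n (M P n)

/-- Average power at most `P` per slot, for each transmitter and each codeword. -/
def CodeFamily.PowerConstrained {𝕜 : Type*} [RCLike 𝕜] (S : CodeFamily 𝕜) : Prop :=
  ∀ P > 0, ∀ n i (m : (k : Fin 2) → Fin (S.M P n k i)),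
    ∑ t, ‖(S.code P n).enc i m t‖ ^ 2 ≤ n * P

/-- The degrees of freedom carried by the four messages are `d k i`: the rates `R P k i` (in nats
per slot) are supported by the code sizes, and `R P k i` grows like `d k i` times the capacity
prelog of a point-to-point channel, which is `(1 / 2) log P` if `𝕜 = ℝ` and `log P` if `𝕜 = ℂ`. -/
def CodeFamily.HasDoF {𝕜 : Type*} [RCLike 𝕜] (S : CodeFamily 𝕜) (d : Fin 2 → Fin 2 → ℝ) : Prop :=
  ∃ R : ℝ → Fin 2 → Fin 2 → ℝ,
    (∀ P > 0, ∀ k i, ∀ᶠ n : ℕ in atTop, n * R P k i ≤ Real.log (S.M P n k i)) ∧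
    ∀ k i, Tendsto (fun P => R P k i / ((Module.finrank ℝ 𝕜 : ℝ) / 2 * Real.log P)) atTop
      (𝓝 (d k i))

/-- At power `P` and for the channel realization `ω`, both receivers decode with error probability
tending to `0` as the block length grows. -/
def CodeFamily.Reliable {𝕜 Ω : Type*} [RCLike 𝕜] (S : CodeFamily 𝕜)
    (H : ℕ → Ω → Fin 2 → Fin 2 → 𝕜) (ω : Ω) (P : ℝ) : Prop :=
  ∀ k, Tendsto (fun n => (S.code P n).errorProb k (channelGain H ω n k)) atTop (𝓝 0)

/-- A total of `D` DoF is achievable almost surely: there are codes, chosen without knowledge of the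
channel realization, with DoF summing to `D`, which for almost every realization are reliable at
all sufficiently high powers. -/
def AchievesTotalDoF {𝕜 Ω : Type*} [RCLike 𝕜] [MeasurableSpace Ω] (μ : Measure Ω)
    (H : ℕ → Ω → Fin 2 → Fin 2 → 𝕜) (D : ℝ) : Prop :=
  ∃ d : Fin 2 → Fin 2 → ℝ, (∀ k i, 0 ≤ d k i) ∧ ∑ k, ∑ i, d k i = D ∧
    ∃ S : CodeFamily 𝕜, S.PowerConstrained ∧ S.HasDoF d ∧
      ∀ᵐ ω ∂μ, ∀ᶠ P in atTop, S.Reliable H ω P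

/-- A total of `D` DoF is achievable in the ergodic sense: as above, but at every power the codes
are reliable for almost every realization. -/
def AchievesErgodicTotalDoF {𝕜 Ω : Type*} [RCLike 𝕜] [MeasurableSpace Ω] (μ : Measure Ω)
    (H : ℕ → Ω → Fin 2 → Fin 2 → 𝕜) (D : ℝ) : Prop :=
  ∃ d : Fin 2 → Fin 2 → ℝ, (∀ k i, 0 ≤ d k i) ∧ ∑ k, ∑ i, d k i = D ∧
    ∃ S : CodeFamily 𝕜, S.PowerConstrained ∧ S.HasDoF d ∧
      ∀ P > 0, ∀ᵐ ω ∂μ, S.Reliable H ω P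

end XChannel

end

/-!
The codes combine interference alignment over three slots with an error-correcting outer code, and
involve neither random coding nor joint decoding.

Alignment. In three consecutive slots the state of one receiver, the *early* one, changes after the
first slot, and the state of the other after the second. Symbols for the early receiver are repeated
in the first two slots, those for the late receiver in the last two. At the receiver for which a
symbol is not meant, the channel is constant while the symbol is repeated, so that subtracting one
signal from the other cancels the symbols of both transmitters at once. At the intended receiver the
channel changes in between, so that two combinations of the three signals give a `2 × 2` system for
its two symbols, whose rows are consecutive block states (`firstCombination_received`,
`secondCombination_received`). Four symbols in three slots yield the total of `4 / 3`.

Outer code. At power `P` and with `L = ⌊log P⌋`, the symbols come from a constellation with spacing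
of order `L ^ 2` and hence with `P ^ (d / 2)` points up to powers of `log P`, where `d` is the real
dimension of the field. A symbol is recovered by zero forcing and rounding, unless the noise exceeds
`L` or the matrix is so badly conditioned that its inverse amplifies the noise by more than `L`. Such
triples are treated as errors of a code over a large alphabet. By the Gilbert–Varshamov bound,
correcting a fraction `η` of errors costs only a fraction of order `η` of the rate and a bounded
additive term (`exists_errorCorrectingCode`, `exists_alignmentCode`). Since `η` may be chosen to tend
to zero as `L` grows, no degrees of freedom are lost (`exists_codeFamily`).

Few errors. Strong noise occurs with a probability that tends to zero in `L`, and Chebyshev's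
inequality controls its frequency. Two consecutive states have a joint density, so that their
determinant is almost surely nonzero and the probability of a bad state also tends to zero. For a
stationary sequence, the maximal ergodic inequality `mul_measure_visits_gt_le` and the Borel–Cantelli
lemma bound the frequency of bad states by a deterministic null sequence, from some random level on
(`exists_tendsto_zero_ae_eventually_visits_le`). For an ergodic sequence the frequency is bounded at
every level (`ae_eventually_visits_le_of_ergodic`).
-/

namespace XChannel

/-! ### Codes in the Hamming metric -/

/-- A word in the ball is determined by a set `S` of at most `D` positions and its values there. -/
theorem card_hammingBall_le {ι A : Type*} [Fintype ι] [DecidableEq ι] [Fintype A] [DecidableEq A]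
    [Nonempty A] (x : ι → A) (D : ℕ) :
    (Finset.univ.filter fun y => hammingDist x y ≤ D).card ≤
      2 ^ Fintype.card ι * Fintype.card A ^ D := by
  classical
  have hsub : (Finset.univ.filter fun y => hammingDist x y ≤ D) ⊆
      (Finset.univ.filter fun S : Finset ι => S.card ≤ D).biUnion
        fun S => Fintype.piFinset fun i => if i ∈ S then Finset.univ else {x i} := by
    intro y hy
    simp only [Finset.mem_filter, Finset.mem_univ, true_and] at hy
    simp only [Finset.mem_biUnion, Finset.mem_filter, Finset.mem_univ, true_and,
      Fintype.mem_piFinset]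
    refine ⟨Finset.univ.filter fun i => x i ≠ y i, hy, fun i => ?_⟩
    by_cases h : x i = y i <;> simp [h]
  calc _ ≤ _ := Finset.card_le_card hsub
    _ ≤ ∑ S ∈ (Finset.univ.filter fun S : Finset ι => S.card ≤ D), Fintype.card A ^ D := by
        refine Finset.card_biUnion_le.trans (Finset.sum_le_sum fun S hS => ?_)
        simp only [Finset.mem_filter, Finset.mem_univ, true_and] at hS
        rw [Fintype.card_piFinset]
        have : ∀ i, (if i ∈ S then (Finset.univ : Finset A) else {x i}).card =
            if i ∈ S then Fintype.card A else 1 := by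
          intro i; split_ifs <;> simp
        simp only [this, Finset.prod_ite_mem, Finset.univ_inter, Finset.prod_const]
        exact Nat.pow_le_pow_right Fintype.card_pos hS
    _ ≤ 2 ^ Fintype.card ι * Fintype.card A ^ D := by
        rw [Finset.sum_const, smul_eq_mul]
        refine Nat.mul_le_mul_right _ ((Finset.card_filter_le _ _).trans ?_)
        simp

/-- The Gilbert–Varshamov bound: a code with minimum distance above `D` that cannot be enlarged is
large, because the Hamming balls of radius `D` around its words cover the whole space. -/
theorem exists_gilbertVarshamov_code (ι A : Type*) [Fintype ι] [DecidableEq ι] [Fintype A]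
    [DecidableEq A] [Nonempty A] (D : ℕ) :
    ∃ C : Finset (ι → A), (∀ x ∈ C, ∀ y ∈ C, hammingDist x y ≤ D → x = y) ∧
      Fintype.card A ^ Fintype.card ι ≤ C.card * (2 ^ Fintype.card ι * Fintype.card A ^ D) := by
  classical
  let sep : Finset (ι → A) → Prop := fun C => ∀ x ∈ C, ∀ y ∈ C, hammingDist x y ≤ D → x = y
  obtain ⟨C, hC, hmax⟩ := Finset.exists_max_image (Finset.univ.filter sep) Finset.card
    ⟨∅, by simp [sep]⟩
  simp only [Finset.mem_filter, Finset.mem_univ, true_and] at hC hmax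
  refine ⟨C, hC, ?_⟩
  have hcover : (Finset.univ : Finset (ι → A)) ⊆
      C.biUnion fun x => Finset.univ.filter fun y => hammingDist x y ≤ D := by
    intro y _
    by_contra hy
    simp only [Finset.mem_biUnion, Finset.mem_filter, Finset.mem_univ, true_and, not_exists,
      not_and, not_le] at hy
    have hyC : y ∉ C := fun h => by simpa using hy y h
    have hins : sep (insert y C) := by
      intro u hu v hv huv
      rw [Finset.mem_insert] at hu hv
      rcases hu with rfl | hu <;> rcases hv with rfl | hv
      · rfl
      · rw [hammingDist_comm] at huv
        exact absurd huv (hy v hv).not_ge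
      · exact absurd huv (hy u hu).not_ge
      · exact hC u hu v hv huv
    have := hmax _ hins
    rw [Finset.card_insert_of_notMem hyC] at this
    omega
  calc Fintype.card A ^ Fintype.card ι = (Finset.univ : Finset (ι → A)).card := by simp
    _ ≤ _ := Finset.card_le_card hcover
    _ ≤ _ := Finset.card_biUnion_le
    _ ≤ ∑ x ∈ C, 2 ^ Fintype.card ι * Fintype.card A ^ D :=
        Finset.sum_le_sum fun x _ => card_hammingBall_le x D
    _ = _ := by rw [Finset.sum_const, smul_eq_mul]

/-- A large code together with a decoder that corrects every pattern of at most `e` errors. -/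
theorem exists_errorCorrectingCode (ι A : Type*) [Fintype ι] [DecidableEq ι] [Fintype A]
    [DecidableEq A] [Nonempty A] (e : ℕ) :
    ∃ (M : ℕ) (c : Fin M → ι → A) (D : (ι → A) → Fin M), 0 < M ∧
      (∀ m v, hammingDist (c m) v ≤ e → D v = m) ∧
      Fintype.card A ^ Fintype.card ι ≤
        M * (2 ^ Fintype.card ι * Fintype.card A ^ (2 * e)) := by
  classical
  obtain ⟨C, hsep, hcard⟩ := exists_gilbertVarshamov_code ι A (2 * e)
  have hpos : 0 < C.card := by
    by_contra h
    have h0 : C.card = 0 := by omega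
    rw [h0, zero_mul] at hcard
    exact absurd (pow_pos (Fintype.card_pos (α := A)) (Fintype.card ι)) hcard.not_gt
  let c : Fin C.card → ι → A := fun m => (C.equivFin.symm m : ι → A)
  refine ⟨C.card, c, fun v => if h : ∃ m, hammingDist (c m) v ≤ e then h.choose else ⟨0, hpos⟩,
    hpos, fun m v hv => ?_, hcard⟩
  have h : ∃ m, hammingDist (c m) v ≤ e := ⟨m, hv⟩
  simp only [dif_pos h]
  have h1 := h.choose_spec
  have : c h.choose = c m := by
    refine hsep _ (C.equivFin.symm _).2 _ (C.equivFin.symm _).2 ?_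
    have h2 := hammingDist_triangle (c h.choose) v (c m)
    rw [hammingDist_comm v] at h2
    exact h2.trans (by omega)
  exact C.equivFin.symm.injective (Subtype.ext this)

/-! ### Constellations -/

/-- The points with integer coordinates in `[0, q)` with respect to an orthonormal basis. -/
theorem exists_constellation (E : Type*) [NormedAddCommGroup E] [InnerProductSpace ℝ E]
    [FiniteDimensional ℝ E] (q : ℕ) :
    ∃ c : (Fin (Module.finrank ℝ E) → Fin (q + 1)) → E,
      (∀ x, ‖c x‖ ≤ Module.finrank ℝ E * q) ∧ ∀ x y, x ≠ y → 1 ≤ ‖c x - c y‖ := by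
  let b := stdOrthonormalBasis ℝ E
  refine ⟨fun x => ∑ l, ((x l : ℕ) : ℝ) • b l, fun x => ?_, fun x y hxy => ?_⟩
  · calc _ ≤ ∑ l, ‖((x l : ℕ) : ℝ) • b l‖ := norm_sum_le _ _
      _ ≤ ∑ l : Fin (Module.finrank ℝ E), (q : ℝ) := by
          refine Finset.sum_le_sum fun l _ => ?_
          rw [norm_smul, b.norm_eq_one, mul_one, Real.norm_natCast]
          exact_mod_cast Nat.lt_succ_iff.mp (x l).2
      _ = _ := by simp
  · obtain ⟨l, hl⟩ := Function.ne_iff.mp hxy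
    have h1 : inner ℝ (b l) (∑ l, ((x l : ℕ) : ℝ) • b l - ∑ l, ((y l : ℕ) : ℝ) • b l) =
        ((x l : ℤ) - (y l : ℤ) : ℤ) := by
      rw [← Finset.sum_sub_distrib]
      simp only [← sub_smul]
      rw [inner_sum]
      simp only [inner_smul_right, orthonormal_iff_ite.mp b.orthonormal]
      simp
    have h2 := abs_real_inner_le_norm (b l)
      (∑ l, ((x l : ℕ) : ℝ) • b l - ∑ l, ((y l : ℕ) : ℝ) • b l)
    rw [h1, b.norm_eq_one, one_mul] at h2
    refine le_trans ?_ h2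
    have h3 : ((x l : ℤ) - (y l : ℤ)) ≠ 0 := by
      intro h
      exact hl (Fin.ext (by omega))
    exact_mod_cast Int.one_le_abs h3

/-- Rounding to the points of a constellation, measurably. -/
theorem exists_measurable_rounding {E A : Type*} [NormedAddCommGroup E] [MeasurableSpace E]
    [OpensMeasurableSpace E] [Finite A] [Nonempty A] [MeasurableSpace A] [DiscreteMeasurableSpace A]
    (c : A → E) {r : ℝ} (hc : ∀ x y, x ≠ y → 2 * r ≤ ‖c x - c y‖) :
    ∃ f : E → A, Measurable f ∧ ∀ x v, ‖v - c x‖ < r → f v = x := by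
  classical
  let x₀ : A := Classical.arbitrary A
  let f : E → A := fun v => if h : ∃ x, ‖v - c x‖ < r then h.choose else x₀
  have hf : ∀ x v, ‖v - c x‖ < r → f v = x := by
    intro x v hv
    have h : ∃ x, ‖v - c x‖ < r := ⟨x, hv⟩
    simp only [f, dif_pos h]
    by_contra hne
    have h1 := hc _ _ hne
    have h2 := h.choose_spec
    have h3 : ‖c h.choose - c x‖ ≤ ‖v - c h.choose‖ + ‖v - c x‖ := by
      rw [norm_sub_rev v (c h.choose)]
      simpa using norm_add_le (c h.choose - v) (v - c x)
    linarith
  refine ⟨f, measurable_to_countable' fun x => ?_, hf⟩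
  have hball : ∀ y, MeasurableSet {v | ‖v - c y‖ < r} := fun y => by
    have : {v | ‖v - c y‖ < r} = Metric.ball (c y) r := by
      ext v; simp [dist_eq_norm]
    rw [this]
    exact Metric.isOpen_ball.measurableSet
  by_cases hx : x = x₀
  · have : f ⁻¹' {x} = (⋃ y ∈ {y | y ≠ x₀}, {v | ‖v - c y‖ < r})ᶜ := by
      ext v
      simp only [Set.mem_preimage, Set.mem_singleton_iff, Set.mem_compl_iff, Set.mem_iUnion,
        Set.mem_ofPred_eq, not_exists]
      refine ⟨fun h y hy hv => hy ?_, fun h => ?_⟩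
      · rw [← hf y v hv, h, hx]
      · by_cases h' : ∃ x, ‖v - c x‖ < r
        · obtain ⟨y, hy⟩ := h'
          rw [hf y v hy, hx]
          by_contra hne
          exact h y hne hy
        · simp only [f, dif_neg h', hx]
    rw [this]
    exact (MeasurableSet.biUnion (Set.to_countable _) fun y _ => hball y).compl
  · have : f ⁻¹' {x} = {v | ‖v - c x‖ < r} := by
      ext v
      refine ⟨fun h => ?_, fun h => hf x v h⟩
      simp only [Set.mem_preimage, Set.mem_singleton_iff] at h
      by_cases h' : ∃ x, ‖v - c x‖ < r
      · obtain ⟨y, hy⟩ := h'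
        have := hf y v hy
        rw [h] at this
        rwa [← this] at hy
      · simp only [f, dif_neg h'] at h
        exact absurd h.symm hx
    rw [this]
    exact hball x

/-! ### The maximal ergodic inequality -/

/-- `maxSum T f n x` is the maximum of `0` and of the first `n` Birkhoff sums of `f` at `x`. -/
noncomputable def maxSum {α : Type*} (T : α → α) (f : α → ℝ) : ℕ → α → ℝ
  | 0 => fun _ => 0
  | n + 1 => fun x => max 0 (f x + maxSum T f n (T x))

section MaximalInequality

variable {α : Type*} {T : α → α} {f : α → ℝ}

theorem maxSum_nonneg (n : ℕ) (x : α) : 0 ≤ maxSum T f n x := by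
  cases n with
  | zero => exact le_rfl
  | succ n => exact le_max_left _ _

theorem maxSum_le_succ (n : ℕ) (x : α) : maxSum T f n x ≤ maxSum T f (n + 1) x := by
  induction n generalizing x with
  | zero => exact le_max_left _ _
  | succ n ih => exact max_le_max le_rfl (add_le_add le_rfl (ih (T x)))

theorem birkhoffSum_le_maxSum (n : ℕ) (x : α) : birkhoffSum T f n x ≤ maxSum T f n x := by
  induction n generalizing x with
  | zero => simp [maxSum]
  | succ n ih =>
    rw [birkhoffSum_succ']
    exact (add_le_add le_rfl (ih (T x))).trans (le_max_right _ _)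

/-- Number of visits to `B` during the first `n` steps of the orbit of `x`. -/
noncomputable def visits (T : α → α) (B : Set α) (n : ℕ) (x : α) : ℝ :=
  birkhoffSum T (B.indicator fun _ => (1 : ℝ)) n x

theorem birkhoffSum_sub_const (T : α → α) (B : Set α) (c : ℝ) (n : ℕ) (x : α) :
    birkhoffSum T (fun y => B.indicator (fun _ => (1 : ℝ)) y - c) n x = visits T B n x - c * n := by
  simp [visits, birkhoffSum, Finset.sum_sub_distrib, mul_comm]

variable [MeasurableSpace α] {ν : Measure α}

theorem measurable_maxSum (hT : Measurable T) (hf : Measurable f) (n : ℕ) :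
    Measurable (maxSum T f n) := by
  induction n with
  | zero => exact measurable_const
  | succ n ih => exact measurable_const.max (hf.add (ih.comp hT))

theorem integrable_maxSum (hT : MeasurePreserving T ν ν) (hf : Integrable f ν) (n : ℕ) :
    Integrable (maxSum T f n) ν := by
  induction n with
  | zero => exact integrable_zero _ _ _
  | succ n ih =>
    exact (integrable_zero _ _ _).sup (hf.add ((hT.integrable_comp ih.aestronglyMeasurable).mpr ih))

/-- The maximal ergodic theorem at a finite horizon: where the maximal sum `S` is positive,
`f ≥ S - S ∘ T`, and `S - S ∘ T` has integral zero. -/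
theorem setIntegral_maxSum_pos_nonneg (hT : MeasurePreserving T ν ν) (hfm : Measurable f)
    (hf : Integrable f ν) (n : ℕ) : 0 ≤ ∫ x in {x | 0 < maxSum T f n x}, f x ∂ν := by
  cases n with
  | zero => simp [maxSum]
  | succ n =>
    set S := maxSum T f (n + 1) with hS
    have hSi : Integrable S ν := integrable_maxSum hT hf _
    have hSm : Measurable S := measurable_maxSum hT.measurable hfm _
    have hTi : Integrable (fun x => S (T x)) ν :=
      (hT.integrable_comp hSi.aestronglyMeasurable).mpr hSi
    have hA : MeasurableSet {x | 0 < S x} := measurableSet_lt measurable_const hSm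
    have h1 : ∫ x in {x | 0 < S x}, (S x - S (T x)) ∂ν ≤ ∫ x in {x | 0 < S x}, f x ∂ν := by
      refine setIntegral_mono_on (hSi.sub hTi).integrableOn hf.integrableOn hA fun x hx => ?_
      have hx' : S x = f x + maxSum T f n (T x) := by
        have : S x = max 0 (f x + maxSum T f n (T x)) := rfl
        have hpos : 0 < S x := hx
        rcases le_total 0 (f x + maxSum T f n (T x)) with h | h
        · rw [this, max_eq_right h]
        · rw [this, max_eq_left h] at hpos
          exact absurd hpos (lt_irrefl _)
      have := maxSum_le_succ (T := T) (f := f) n (T x)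
      rw [← hS] at this
      linarith
    have h2 : ∫ x in {x | 0 < S x}, S x ∂ν = ∫ x, S x ∂ν := by
      refine setIntegral_eq_integral_of_forall_compl_eq_zero fun x hx => ?_
      exact le_antisymm (not_lt.mp hx) (maxSum_nonneg _ _)
    have h3 : ∫ x in {x | 0 < S x}, S (T x) ∂ν ≤ ∫ x, S (T x) ∂ν :=
      setIntegral_le_integral hTi (ae_of_all _ fun x => maxSum_nonneg _ _)
    have h4 : ∫ x, S (T x) ∂ν = ∫ x, S x ∂ν := by
      have := integral_map (μ := ν) hT.measurable.aemeasurable (f := S)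
        (by rw [hT.map_eq]; exact hSi.aestronglyMeasurable)
      rw [hT.map_eq] at this
      exact this.symm
    rw [integral_sub hSi.integrableOn hTi.integrableOn, h2] at h1
    linarith

/-- Weak-type maximal inequality for the frequency of visits to `B`. -/
theorem mul_measure_visits_gt_le [IsProbabilityMeasure ν] (hT : MeasurePreserving T ν ν)
    {B : Set α} (hB : MeasurableSet B) {c : ℝ} (hc : 0 ≤ c) :
    c * ν.real {x | ∃ n : ℕ, c * n < visits T B n x} ≤ ν.real B := by
  set f : α → ℝ := fun y => B.indicator (fun _ => (1 : ℝ)) y - c with hfdef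
  have hfm : Measurable f := (measurable_const.indicator hB).sub measurable_const
  have hind : Integrable (B.indicator fun _ => (1 : ℝ)) ν := (integrable_const _).indicator hB
  have hf : Integrable f ν := hind.sub (integrable_const c)
  set A : ℕ → Set α := fun n => {x | 0 < maxSum T f n x} with hA
  have hAm : ∀ n, MeasurableSet (A n) := fun n =>
    measurableSet_lt measurable_const (measurable_maxSum hT.measurable hfm n)
  have hAmono : Monotone A := monotone_nat_of_le_succ fun n x hx =>
    lt_of_lt_of_le hx (maxSum_le_succ n x)
  have hbound : ∀ n, c * ν.real (A n) ≤ ν.real B := by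
    intro n
    have h := setIntegral_maxSum_pos_nonneg hT hfm hf n
    have h1 : ∫ x in A n, f x ∂ν = ν.real (B ∩ A n) - c * ν.real (A n) := by
      rw [hfdef, integral_sub hind.integrableOn (integrable_const c).integrableOn,
        integral_indicator_const _ hB]
      simp [measureReal_restrict_apply hB, mul_comm]
    have h2 : ν.real (B ∩ A n) ≤ ν.real B := measureReal_mono Set.inter_subset_left
    have h3 : 0 ≤ ν.real (B ∩ A n) - c * ν.real (A n) := h1 ▸ h
    linarith
  have hlim : Tendsto (fun n => ν.real (A n)) atTop (𝓝 (ν.real (⋃ n, A n))) := by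
    have := tendsto_measure_iUnion_atTop (μ := ν) hAmono
    exact (ENNReal.tendsto_toReal (measure_ne_top _ _)).comp this
  have hle : ν.real {x | ∃ n : ℕ, c * n < visits T B n x} ≤ ν.real (⋃ n, A n) := by
    refine measureReal_mono ?_
    rintro x ⟨n, hn⟩
    refine Set.mem_iUnion.mpr ⟨n, lt_of_lt_of_le ?_ (birkhoffSum_le_maxSum n x)⟩
    rw [hfdef, birkhoffSum_sub_const]
    linarith
  calc _ ≤ c * ν.real (⋃ n, A n) := mul_le_mul_of_nonneg_left hle hc
    _ ≤ ν.real B := le_of_tendsto (hlim.const_mul c) (Eventually.of_forall hbound)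

/-! ### Frequencies of rare states -/

/-- In an ergodic system the frequency of visits to `B` does not exceed any `c > ν B` in the long
run: the set where the number of visits minus `c * n` is unbounded in `n` is invariant, and by the
maximal inequality it does not have full measure. -/
theorem ae_eventually_visits_le_of_ergodic [IsProbabilityMeasure ν] (hT : Ergodic T ν)
    {B : Set α} (hB : MeasurableSet B) {c : ℝ} (hc : ν.real B < c) :
    ∀ᵐ x ∂ν, ∀ᶠ n : ℕ in atTop, visits T B n x ≤ c * n := by
  -- The bound for `c'` holds up to an additive constant, which `(c - c') * n` eventually exceeds.
  obtain ⟨c', hc', hc'c⟩ := exists_between hc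
  have hc'0 : 0 < c' := lt_of_le_of_lt measureReal_nonneg hc'
  set W : Set α := {x | ∀ K : ℕ, ∃ n : ℕ, c' * n + K < visits T B n x} with hW
  have hvm : ∀ n, Measurable (visits T B n) := fun n => by
    unfold visits birkhoffSum
    exact Finset.measurable_sum _ fun i _ =>
      (measurable_const.indicator hB).comp (hT.toMeasurePreserving.measurable.iterate i)
  have hWm : MeasurableSet W := by
    have : W = ⋂ K : ℕ, ⋃ n : ℕ, {x | c' * n + K < visits T B n x} := by
      ext x; simp [hW]
    rw [this]
    exact MeasurableSet.iInter fun K => MeasurableSet.iUnion fun n =>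
      measurableSet_lt measurable_const (hvm n)
  have hsucc : ∀ n x, visits T B (n + 1) x =
      B.indicator (fun _ => (1 : ℝ)) x + visits T B n (T x) := fun n x => birkhoffSum_succ' _ _ _ _
  have hind0 : ∀ x, 0 ≤ B.indicator (fun _ => (1 : ℝ)) x := fun x =>
    Set.indicator_nonneg (fun _ _ => zero_le_one) x
  have hind1 : ∀ x, B.indicator (fun _ => (1 : ℝ)) x ≤ 1 := fun x =>
    Set.indicator_le_self' (fun _ _ => zero_le_one) x
  obtain ⟨k, hk⟩ := exists_nat_ge c'
  have hinv : T ⁻¹' W = W := by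
    ext x
    constructor
    · intro h K
      obtain ⟨n, hn⟩ := h (K + k)
      refine ⟨n + 1, ?_⟩
      rw [hsucc]
      have := hind0 x
      push_cast at hn ⊢
      linarith
    · intro h K
      obtain ⟨n, hn⟩ := h (K + 1)
      cases n with
      | zero =>
        have : (0 : ℝ) ≤ (K : ℝ) := K.cast_nonneg
        simp [visits] at hn
        linarith
      | succ n =>
        refine ⟨n, ?_⟩
        rw [hsucc] at hn
        have := hind1 x
        push_cast at hn
        linarith
  have hWlt : ν.real W < 1 := by
    have h1 := mul_measure_visits_gt_le hT.toMeasurePreserving hB hc'0.le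
    have h2 : ν.real W ≤ ν.real {x | ∃ n : ℕ, c' * n < visits T B n x} :=
      measureReal_mono fun x hx => by simpa using hx 0
    by_contra h
    have h3 : 1 ≤ ν.real {x | ∃ n : ℕ, c' * n < visits T B n x} := (not_lt.mp h).trans h2
    nlinarith
  have hW0 : ν W = 0 := by
    rcases hT.toPreErgodic.prob_eq_zero_or_one hWm hinv with h | h
    · exact h
    · simp [Measure.real, h] at hWlt
  filter_upwards [measure_eq_zero_iff_ae_notMem.mp hW0] with x hx
  simp only [hW, Set.mem_ofPred_eq, not_forall, not_exists, not_lt] at hx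
  obtain ⟨K, hK⟩ := hx
  have hlim : Tendsto (fun n : ℕ => (c - c') * (n : ℝ)) atTop atTop :=
    tendsto_natCast_atTop_atTop.const_mul_atTop (by linarith)
  filter_upwards [hlim.eventually_ge_atTop (K : ℝ)] with n hn
  have := hK n
  linarith

/-- In a stationary system, the frequencies of visits to a decreasing sequence of sets whose
measures tend to zero are almost surely dominated, from some set on, by a deterministic null
sequence: by the maximal inequality and the Borel–Cantelli lemma along a sparse subsequence. -/
theorem exists_tendsto_zero_ae_eventually_visits_le [IsProbabilityMeasure ν]
    (hT : MeasurePreserving T ν ν) {B : ℕ → Set α} (hB : ∀ L, MeasurableSet (B L))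
    (hanti : Antitone B) (hlim : Tendsto (fun L => ν.real (B L)) atTop (𝓝 0)) :
    ∃ δ : ℕ → ℝ, Tendsto δ atTop (𝓝 0) ∧
      ∀ᵐ x ∂ν, ∀ᶠ L in atTop, ∀ n : ℕ, visits T (B L) n x ≤ δ L * n := by
  have hex : ∀ m : ℕ, ∃ L, ν.real (B L) ≤ (1 / 4 : ℝ) ^ m := fun m =>
    (hlim.eventually (eventually_le_nhds (b := (1 / 4 : ℝ) ^ m) (by positivity))).exists
  choose ℓ hℓ using hex
  set E : ℕ → Set α := fun m => {x | ∃ n : ℕ, (1 / 2 : ℝ) ^ m * n < visits T (B (ℓ m)) n x}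
  have hE : ∀ m, ν.real (E m) ≤ (1 / 2 : ℝ) ^ m := by
    intro m
    have h1 := mul_measure_visits_gt_le hT (hB (ℓ m)) (c := (1 / 2 : ℝ) ^ m) (by positivity)
    have h2 : (1 / 4 : ℝ) ^ m = (1 / 2 : ℝ) ^ m * (1 / 2 : ℝ) ^ m := by
      rw [← mul_pow]; norm_num
    have h3 := h1.trans (hℓ m)
    rw [h2] at h3
    exact le_of_mul_le_mul_left h3 (by positivity)
  have hsum : ∑' m, ν (E m) ≠ ⊤ := by
    have h1 : ∀ m, ν (E m) ≤ ENNReal.ofReal ((1 / 2 : ℝ) ^ m) := fun m => by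
      rw [← ofReal_measureReal (measure_ne_top _ _)]
      exact ENNReal.ofReal_le_ofReal (hE m)
    refine ne_top_of_le_ne_top ?_ (ENNReal.tsum_le_tsum h1)
    exact (summable_geometric_of_lt_one (by norm_num) (by norm_num)).tsum_ofReal_ne_top
  -- `m L` is the last index up to `L` whose threshold `ℓ` has been reached.
  classical
  let m : ℕ → ℕ := fun L => Nat.findGreatest (fun m => ℓ m ≤ L) L
  have hm : Tendsto m atTop atTop := by
    refine tendsto_atTop.mpr fun b => ?_
    filter_upwards [eventually_ge_atTop (max b (ℓ b))] with L hL
    exact Nat.le_findGreatest ((le_max_left _ _).trans hL) ((le_max_right _ _).trans hL)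
  have hmℓ : ∀ᶠ L in atTop, ℓ (m L) ≤ L := by
    filter_upwards [eventually_ge_atTop (ℓ 0)] with L hL
    exact Nat.findGreatest_spec (P := fun m => ℓ m ≤ L) (Nat.zero_le L) hL
  refine ⟨fun L => (1 / 2 : ℝ) ^ m L,
    (tendsto_pow_atTop_nhds_zero_of_lt_one (by norm_num) (by norm_num)).comp hm, ?_⟩
  filter_upwards [ae_eventually_notMem hsum] with x hx
  filter_upwards [hm.eventually hx, hmℓ] with L hL hle n
  have hL' : visits T (B (ℓ (m L))) n x ≤ (1 / 2 : ℝ) ^ m L * n := by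
    by_contra h
    exact hL ⟨n, not_le.mp h⟩
  refine le_trans ?_ hL'
  unfold visits birkhoffSum
  exact Finset.sum_le_sum fun i _ =>
    Set.indicator_le_indicator_of_subset (hanti hle) (fun _ => zero_le_one) _

end MaximalInequality

/-! ### Badly conditioned channel states -/

section ChannelStates

variable {𝕜 : Type*} [RCLike 𝕜]

/-- Determinant of the `2 × 2` matrix with rows `g` and `h`. -/
def stateDet (g h : Fin 2 → 𝕜) : 𝕜 := g 0 * h 1 - g 1 * h 0

/-- Sum of the absolute values of the entries of the matrix with rows `g` and `h`. -/
def stateNorm (g h : Fin 2 → 𝕜) : ℝ := ‖g 0‖ + ‖g 1‖ + ‖h 0‖ + ‖h 1‖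

/-- The matrix with rows `g` and `h` is singular, or inverting it may amplify noise by a factor
larger than `L`. -/
def BadState (L : ℕ) (g h : Fin 2 → 𝕜) : Prop :=
  stateDet g h = 0 ∨ L * ‖stateDet g h‖ < stateNorm g h

theorem measurable_stateDet :
    Measurable fun p : (Fin 2 → 𝕜) × (Fin 2 → 𝕜) => stateDet p.1 p.2 := by
  unfold stateDet; fun_prop

theorem measurableSet_badState (L : ℕ) :
    MeasurableSet {p : (Fin 2 → 𝕜) × (Fin 2 → 𝕜) | BadState L p.1 p.2} := by
  have h1 : MeasurableSet {p : (Fin 2 → 𝕜) × (Fin 2 → 𝕜) | stateDet p.1 p.2 = 0} :=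
    measurable_stateDet (measurableSet_singleton 0)
  have h2 : MeasurableSet {p : (Fin 2 → 𝕜) × (Fin 2 → 𝕜) |
      L * ‖stateDet p.1 p.2‖ < stateNorm p.1 p.2} := by
    refine measurableSet_lt (measurable_stateDet.norm.const_mul _) ?_
    unfold stateNorm; fun_prop
  exact h1.union h2

theorem BadState.anti {L L' : ℕ} (hL : L ≤ L') {g h : Fin 2 → 𝕜} (hb : BadState L' g h) :
    BadState L g h := by
  refine hb.imp_right fun hlt => lt_of_le_of_lt ?_ hlt
  gcongr

/-- For `g ≠ 0` the vectors `h` with `stateDet g h = 0` form a proper subspace. -/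
theorem volume_stateDet_eq_zero :
    volume {p : (Fin 2 → 𝕜) × (Fin 2 → 𝕜) | stateDet p.1 p.2 = 0} = 0 := by
  have hm : MeasurableSet {p : (Fin 2 → 𝕜) × (Fin 2 → 𝕜) | stateDet p.1 p.2 = 0} :=
    measurable_stateDet (measurableSet_singleton 0)
  rw [Measure.volume_eq_prod, Measure.measure_prod_null hm]
  have hg : ∀ᵐ g : Fin 2 → 𝕜, g ≠ 0 := by
    have : volume ({0} : Set (Fin 2 → 𝕜)) = 0 := by
      simpa using Measure.addHaar_submodule (volume : Measure (Fin 2 → 𝕜)) ⊥ bot_ne_top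
    exact measure_eq_zero_iff_ae_notMem.mp this
  filter_upwards [hg] with g hg
  let φ : (Fin 2 → 𝕜) →ₗ[ℝ] 𝕜 :=
    { toFun := fun h => stateDet g h
      map_add' := fun a b => by simp [stateDet]; ring
      map_smul' := fun r a => by simp [stateDet, smul_sub] }
  have hker : φ.ker ≠ ⊤ := by
    intro h
    have hφ : ∀ v, φ v = 0 := fun v => by
      have : v ∈ φ.ker := h ▸ Submodule.mem_top
      exact this
    refine hg (funext fun i => ?_)
    fin_cases i
    · simpa [φ, stateDet] using hφ ![0, 1]
    · simpa [φ, stateDet] using hφ ![1, 0]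
  exact Measure.addHaar_submodule volume φ.ker hker

variable {Ω : Type*} {H : ℕ → Ω → Fin 2 → Fin 2 → 𝕜}

/-- Sequences of block states whose first two states form a badly conditioned matrix. -/
def badSequences (𝕜 : Type*) [RCLike 𝕜] (L : ℕ) : Set (ℕ → Fin 2 → 𝕜) :=
  {s | BadState L (s 0) (s 1)}

theorem measurableSet_badSequences (L : ℕ) : MeasurableSet (badSequences 𝕜 L) :=
  measurableSet_preimage ((measurable_pi_apply (X := fun _ : ℕ => Fin 2 → 𝕜) 0).prodMk
    (measurable_pi_apply 1)) (measurableSet_badState L)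

theorem antitone_badSequences : Antitone (badSequences 𝕜) := fun _ _ hL _ hs => hs.anti hL

theorem blockShift_iterate {𝕜 : Type*} (s : ℕ → Fin 2 → 𝕜) (n b : ℕ) : blockShift^[n] s b = s (b + n) := by
  induction n generalizing s with
  | zero => rfl
  | succ n ih =>
    rw [Function.iterate_succ_apply, ih]
    simp [blockShift, Nat.add_assoc]

open Classical in
theorem visits_badSequences (s : ℕ → Fin 2 → 𝕜) (L n : ℕ) :
    visits blockShift (badSequences 𝕜 L) n s =
      ((Finset.range n).filter fun b => BadState L (s b) (s (b + 1))).card := by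
  simp [visits, birkhoffSum, Set.indicator_apply, badSequences, blockShift_iterate,
    Finset.sum_boole, Nat.add_comm]

/-- The realization `ω` of the fading seen by receiver `k` has at most a fraction `δ` of badly
conditioned pairs of consecutive block states, over long horizons. -/
def RarelyBad (H : ℕ → Ω → Fin 2 → Fin 2 → 𝕜) (ω : Ω) (k : Fin 2) (L : ℕ) (δ : ℝ) : Prop :=
  ∀ᶠ n : ℕ in atTop, visits blockShift (badSequences 𝕜 L) n (fun b => H b ω k) ≤ δ * n

theorem RarelyBad.mono {ω : Ω} {k : Fin 2} {L : ℕ} {δ δ' : ℝ} (h : RarelyBad H ω k L δ)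
    (hδ : δ ≤ δ') : RarelyBad H ω k L δ' := by
  filter_upwards [h] with n hn
  exact hn.trans (by gcongr)

variable [MeasurableSpace Ω] {μ : Measure Ω}

theorem measurable_fading (hmeas : ∀ b, Measurable (H b)) (k : Fin 2) :
    Measurable fun ω b => H b ω k :=
  measurable_pi_lambda _ fun b => (measurable_pi_apply k).comp (hmeas b)

theorem isProbabilityMeasure_fadingLaw [IsProbabilityMeasure μ] (hmeas : ∀ b, Measurable (H b))
    (k : Fin 2) : IsProbabilityMeasure (fadingLaw μ H k) :=
  Measure.isProbabilityMeasure_map (measurable_fading hmeas k).aemeasurable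

/-- Two consecutive block states with a joint density form an invertible matrix almost surely. -/
theorem tendsto_fadingLaw_badSequences [IsProbabilityMeasure μ] (hmeas : ∀ b, Measurable (H b))
    (hgen : GenericFading μ H) (k : Fin 2) :
    Tendsto (fun L => (fadingLaw μ H k).real (badSequences 𝕜 L)) atTop (𝓝 0) := by
  have := isProbabilityMeasure_fadingLaw (μ := μ) hmeas k
  have hsub : ⋂ L, badSequences 𝕜 L ⊆ {s | stateDet (s 0) (s 1) = 0} := by
    intro s hs
    by_contra hne
    have hpos : 0 < ‖stateDet (s 0) (s 1)‖ := norm_pos_iff.mpr hne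
    obtain ⟨L, hL⟩ := exists_nat_ge (stateNorm (s 0) (s 1) / ‖stateDet (s 0) (s 1)‖)
    rcases Set.mem_iInter.mp hs L with h | h
    · exact hne h
    · rw [div_le_iff₀ hpos] at hL
      exact absurd h hL.not_gt
  have hzero : fadingLaw μ H k (⋂ L, badSequences 𝕜 L) = 0 := by
    refine measure_mono_null hsub ?_
    have hm : Measurable fun s : ℕ → Fin 2 → 𝕜 => stateDet (s 0) (s 1) :=
      measurable_stateDet.comp ((measurable_pi_apply (X := fun _ : ℕ => Fin 2 → 𝕜) 0).prodMk
        (measurable_pi_apply 1))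
    have hms : MeasurableSet {s : ℕ → Fin 2 → 𝕜 | stateDet (s 0) (s 1) = 0} :=
      hm (measurableSet_singleton 0)
    rw [fadingLaw, Measure.map_apply (measurable_fading hmeas k) hms]
    have h0 := hgen k 0 (volume_stateDet_eq_zero (𝕜 := 𝕜))
    have hmd : MeasurableSet {p : (Fin 2 → 𝕜) × (Fin 2 → 𝕜) | stateDet p.1 p.2 = 0} :=
      measurable_stateDet (measurableSet_singleton 0)
    rwa [Measure.map_apply (by fun_prop) hmd] at h0
  have h := tendsto_measure_iInter_atTop (μ := fadingLaw μ H k)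
    (fun L => (measurableSet_badSequences (𝕜 := 𝕜) L).nullMeasurableSet) antitone_badSequences
    ⟨0, measure_ne_top _ _⟩
  rw [hzero] at h
  exact (ENNReal.tendsto_toReal ENNReal.zero_ne_top).comp h

/-- Without ergodicity the long-run frequency of bad states is random: it is below a deterministic
null sequence only from some level on, which depends on the realization. -/
theorem exists_ae_eventually_rarelyBad [IsProbabilityMeasure μ] (hmeas : ∀ b, Measurable (H b))
    (hstat : StationaryFading μ H) (hgen : GenericFading μ H) :
    ∃ δ : ℕ → ℝ, Tendsto δ atTop (𝓝 0) ∧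
      ∀ᵐ ω ∂μ, ∀ᶠ L in atTop, ∀ k, RarelyBad H ω k L (δ L) := by
  have hk : ∀ k, ∃ δ : ℕ → ℝ, Tendsto δ atTop (𝓝 0) ∧
      ∀ᵐ ω ∂μ, ∀ᶠ L in atTop, RarelyBad H ω k L (δ L) := by
    intro k
    have := isProbabilityMeasure_fadingLaw (μ := μ) hmeas k
    obtain ⟨δ, hδ, hae⟩ := exists_tendsto_zero_ae_eventually_visits_le (hstat k)
      measurableSet_badSequences antitone_badSequences
      (tendsto_fadingLaw_badSequences hmeas hgen k)
    refine ⟨δ, hδ, ?_⟩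
    filter_upwards [ae_of_ae_map (measurable_fading hmeas k).aemeasurable hae] with ω hω
    filter_upwards [hω] with L hL
    exact Eventually.of_forall hL
  choose δ hδ hae using hk
  refine ⟨fun L => max (δ 0 L) (δ 1 L), by simpa using (hδ 0).max (hδ 1), ?_⟩
  filter_upwards [hae 0, hae 1] with ω h0 h1
  filter_upwards [h0, h1] with L h0 h1
  exact Fin.forall_fin_two.mpr ⟨h0.mono (le_max_left _ _), h1.mono (le_max_right _ _)⟩

/-- With ergodicity the bound on the frequency of bad states holds at every level. -/
theorem exists_ae_rarelyBad_of_ergodic [IsProbabilityMeasure μ] (hmeas : ∀ b, Measurable (H b))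
    (hgen : GenericFading μ H) (herg : ErgodicFading μ H) :
    ∃ δ : ℕ → ℝ, Tendsto δ atTop (𝓝 0) ∧ ∀ L, ∀ᵐ ω ∂μ, ∀ k, RarelyBad H ω k L (δ L) := by
  set β : Fin 2 → ℕ → ℝ := fun k L => (fadingLaw μ H k).real (badSequences 𝕜 L) + 1 / (L + 1)
  have hβ : ∀ k, Tendsto (β k) atTop (𝓝 0) := fun k => by
    simpa [β] using (tendsto_fadingLaw_badSequences hmeas hgen k).add
      tendsto_one_div_add_atTop_nhds_zero_nat
  have hae : ∀ k L, ∀ᵐ ω ∂μ, RarelyBad H ω k L (β k L) := by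
    intro k L
    have := isProbabilityMeasure_fadingLaw (μ := μ) hmeas k
    refine ae_of_ae_map (measurable_fading hmeas k).aemeasurable
      (ae_eventually_visits_le_of_ergodic (herg k) (measurableSet_badSequences L) ?_)
    exact lt_add_of_pos_right _ (by positivity)
  refine ⟨fun L => max (β 0 L) (β 1 L), by simpa using (hβ 0).max (hβ 1), fun L => ?_⟩
  filter_upwards [hae 0 L, hae 1 L] with ω h0 h1
  exact Fin.forall_fin_two.mpr ⟨h0.mono (le_max_left _ _), h1.mono (le_max_right _ _)⟩

end ChannelStates

/-! ### Interference alignment over three slots -/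

section Alignment

variable {𝕜 : Type*} [RCLike 𝕜] {n : ℕ}

/-- Slots are grouped in triples; this is slot `p` of the `j`-th triple. -/
def slot (j : Fin (n / 3)) (p : Fin 3) : Fin n := ⟨3 * j + p, by omega⟩

/-- The receiver whose channel state changes after the first slot of the `j`-th triple. The state of
the other receiver changes after the second slot. -/
def earlyReceiver (j : ℕ) : Fin 2 := if j % 2 = 0 then 0 else 1

/-- Symbols for receiver `k` are repeated in two slots of each triple, between which the channel
state of receiver `k` changes and that of the other receiver does not. -/
def ActiveSlot (k : Fin 2) (j p : ℕ) : Prop := if k = earlyReceiver j then p ≠ 2 else p ≠ 0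

instance (k : Fin 2) (j p : ℕ) : Decidable (ActiveSlot k j p) := by
  unfold ActiveSlot; infer_instance

/-- The signal that carries one symbol `X k j` for each receiver `k` and each triple `j`. -/
def alignedWord (X : Fin 2 → Fin (n / 3) → 𝕜) (t : Fin n) : 𝕜 :=
  ∑ k, if h : (t : ℕ) / 3 < n / 3 ∧ ActiveSlot k (t / 3) (t % 3) then X k ⟨t / 3, h.1⟩ else 0

theorem alignedWord_slot (X : Fin 2 → Fin (n / 3) → 𝕜) (j : Fin (n / 3)) (p : Fin 3) :
    alignedWord X (slot j p) = ∑ k, if ActiveSlot k j p then X k j else 0 := by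
  have h1 : (3 * (j : ℕ) + p) / 3 = j := by omega
  have h2 : (3 * (j : ℕ) + p) % 3 = p := by omega
  simp [alignedWord, slot, h1, h2, j.2]

theorem norm_alignedWord_le {X : Fin 2 → Fin (n / 3) → 𝕜} {B : ℝ} (hB : 0 ≤ B)
    (hX : ∀ k j, ‖X k j‖ ≤ B) (t : Fin n) : ‖alignedWord X t‖ ≤ 2 * B := by
  refine (norm_sum_le _ _).trans ?_
  have : ∀ k : Fin 2, ‖(if h : (t : ℕ) / 3 < n / 3 ∧ ActiveSlot k (t / 3) (t % 3) then
      X k ⟨t / 3, h.1⟩ else 0)‖ ≤ B := by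
    intro k
    split_ifs with h
    · exact hX _ _
    · simpa using hB
  exact (Finset.sum_le_sum fun k _ => this k).trans (by simp)

/-- Combination of the signals in a triple from which the interference cancels, and in which the
symbols for receiver `k` are weighted by the gains in the first slot. -/
def firstCombination (k : Fin 2) (y : Fin n → 𝕜) (j : Fin (n / 3)) : 𝕜 :=
  if k = earlyReceiver j then y (slot j 0) else y (slot j 1) - y (slot j 0)

/-- Combination of the signals in a triple from which the interference cancels, and in which the
symbols for receiver `k` are weighted by the gains in the last slot. -/
def secondCombination (k : Fin 2) (y : Fin n → 𝕜) (j : Fin (n / 3)) : 𝕜 :=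
  if k = earlyReceiver j then y (slot j 1) - y (slot j 2) else y (slot j 2)

/-- The gains seen by receiver `k` follow the staggered coherence blocks. -/
def Staggered (k : Fin 2) (g : Fin n → Fin 2 → 𝕜) : Prop :=
  ∀ j : Fin (n / 3), if k = earlyReceiver j then g (slot j 1) = g (slot j 2) else g (slot j 0) = g (slot j 1)

/-- Interference alignment: the symbols `X i k' j` for the other receiver `k' ≠ k` drop out. -/
theorem firstCombination_received {k : Fin 2} {g : Fin n → Fin 2 → 𝕜} (hg : Staggered k g)
    (X : Fin 2 → Fin 2 → Fin (n / 3) → 𝕜) (z : Fin n → 𝕜) (j : Fin (n / 3)) :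
    firstCombination k (fun t => (∑ i, g t i * alignedWord (X i) t) + z t) j =
      (∑ i, g (slot j 0) i * X i k j) + firstCombination k z j := by
  have h := hg j
  by_cases hj : (j : ℕ) % 2 = 0 <;> fin_cases k <;>
    simp [firstCombination, alignedWord_slot, earlyReceiver, ActiveSlot, hj] at h ⊢ <;>
    simp [h] <;> ring

theorem secondCombination_received {k : Fin 2} {g : Fin n → Fin 2 → 𝕜} (hg : Staggered k g)
    (X : Fin 2 → Fin 2 → Fin (n / 3) → 𝕜) (z : Fin n → 𝕜) (j : Fin (n / 3)) :
    secondCombination k (fun t => (∑ i, g t i * alignedWord (X i) t) + z t) j =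
      (∑ i, g (slot j 2) i * X i k j) + secondCombination k z j := by
  have h := hg j
  by_cases hj : (j : ℕ) % 2 = 0 <;> fin_cases k <;>
    simp [secondCombination, alignedWord_slot, earlyReceiver, ActiveSlot, hj] at h ⊢ <;>
    simp [h] <;> ring

theorem norm_firstCombination_le {k : Fin 2} {z : Fin n → 𝕜} {j : Fin (n / 3)} {B : ℝ}
    (hz : ∀ p, ‖z (slot j p)‖ ≤ B) : ‖firstCombination k z j‖ ≤ 2 * B := by
  have := (norm_nonneg _).trans (hz 0)
  unfold firstCombination
  split_ifs
  · linarith [hz 0]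
  · linarith [norm_sub_le (z (slot j 1)) (z (slot j 0)), hz 0, hz 1]

theorem norm_secondCombination_le {k : Fin 2} {z : Fin n → 𝕜} {j : Fin (n / 3)} {B : ℝ}
    (hz : ∀ p, ‖z (slot j p)‖ ≤ B) : ‖secondCombination k z j‖ ≤ 2 * B := by
  have := (norm_nonneg _).trans (hz 0)
  unfold secondCombination
  split_ifs
  · linarith [norm_sub_le (z (slot j 1)) (z (slot j 2)), hz 1, hz 2]
  · linarith [hz 2]

/-- Zero forcing: Cramer's rule for the system with rows `g`, `h` and right-hand side `r`, `r'`. -/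
def zeroForcing (g h : Fin 2 → 𝕜) (r r' : 𝕜) : Fin 2 → 𝕜 :=
  ![(r * h 1 - r' * g 1) / stateDet g h, (r' * g 0 - r * h 0) / stateDet g h]

theorem zeroForcing_apply {g h : Fin 2 → 𝕜} (hdet : stateDet g h ≠ 0) (s : Fin 2 → 𝕜) (w w' : 𝕜)
    (i : Fin 2) : zeroForcing g h ((∑ i, g i * s i) + w) ((∑ i, h i * s i) + w') i =
      s i + zeroForcing g h w w' i := by
  fin_cases i <;> simp [zeroForcing] <;> field_simp <;> simp [stateDet] <;> ring

theorem norm_zeroForcing_le {L : ℕ} {g h : Fin 2 → 𝕜} (hgood : ¬ BadState L g h) {w w' : 𝕜} {B : ℝ}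
    (hw : ‖w‖ ≤ B) (hw' : ‖w'‖ ≤ B) (i : Fin 2) : ‖zeroForcing g h w w' i‖ ≤ L * B := by
  simp only [BadState, not_or, not_lt] at hgood
  obtain ⟨hdet, hnorm⟩ := hgood
  have hpos : 0 < ‖stateDet g h‖ := norm_pos_iff.mpr hdet
  have hB : 0 ≤ B := (norm_nonneg _).trans hw
  have key : ∀ u v : 𝕜, ‖u‖ + ‖v‖ ≤ stateNorm g h → ∀ a b : 𝕜, ‖a‖ ≤ B → ‖b‖ ≤ B →
      ‖(a * u - b * v) / stateDet g h‖ ≤ L * B := by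
    intro u v huv a b ha hb
    rw [norm_div, div_le_iff₀ hpos]
    calc ‖a * u - b * v‖ ≤ ‖a‖ * ‖u‖ + ‖b‖ * ‖v‖ := by
          simpa [norm_mul] using norm_sub_le (a * u) (b * v)
      _ ≤ B * ‖u‖ + B * ‖v‖ := by gcongr
      _ = B * (‖u‖ + ‖v‖) := by ring
      _ ≤ B * (L * ‖stateDet g h‖) := by gcongr; exact huv.trans hnorm
      _ = _ := by ring
  fin_cases i
  · exact key _ _ (by unfold stateNorm; linarith [norm_nonneg (g 0), norm_nonneg (h 0)]) _ _ hw hw'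
  · exact key _ _ (by unfold stateNorm; linarith [norm_nonneg (g 1), norm_nonneg (h 1)]) _ _ hw' hw

theorem measurable_firstCombination (k : Fin 2) (j : Fin (n / 3)) :
    Measurable fun y : Fin n → 𝕜 => firstCombination k y j := by
  unfold firstCombination
  split_ifs <;> fun_prop

theorem measurable_secondCombination (k : Fin 2) (j : Fin (n / 3)) :
    Measurable fun y : Fin n → 𝕜 => secondCombination k y j := by
  unfold secondCombination
  split_ifs <;> fun_prop

theorem measurable_zeroForcing (k : Fin 2) (j : Fin (n / 3)) (i : Fin 2) :
    Measurable fun p : (Fin n → Fin 2 → 𝕜) × (Fin n → 𝕜) =>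
      zeroForcing (p.1 (slot j 0)) (p.1 (slot j 2)) (firstCombination k p.2 j)
        (secondCombination k p.2 j) i := by
  have h1 := (measurable_firstCombination (𝕜 := 𝕜) k j).comp
    (measurable_snd : Measurable (Prod.snd : (Fin n → Fin 2 → 𝕜) × (Fin n → 𝕜) → _))
  have h2 := (measurable_secondCombination (𝕜 := 𝕜) k j).comp
    (measurable_snd : Measurable (Prod.snd : (Fin n → Fin 2 → 𝕜) × (Fin n → 𝕜) → _))
  simp only [Function.comp_def] at h1 h2
  fin_cases i <;> simp [zeroForcing, stateDet] <;> fun_prop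

open Classical in
theorem card_noisyTriples_le (z : Fin n → 𝕜) (L : ℕ) :
    (Finset.univ.filter fun j : Fin (n / 3) => ∃ p, (L : ℝ) < ‖z (slot j p)‖).card ≤
      (Finset.univ.filter fun t => (L : ℝ) < ‖z t‖).card := by
  rw [← Finset.card_map Fin.valEmbedding]
  refine (Finset.card_le_card ?_).trans
    (Finset.card_image_le (f := fun t : Fin n => (t : ℕ) / 3))
  intro a ha
  simp only [Finset.mem_map, Finset.mem_filter, Finset.mem_univ, true_and,
    Fin.valEmbedding_apply] at ha
  obtain ⟨j, ⟨p, hp⟩, rfl⟩ := ha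
  refine Finset.mem_image.mpr ⟨slot j p, by simpa using hp, ?_⟩
  simp only [slot]
  omega

open Classical in
/-- A code for the X channel obtained by mapping an error-correcting code to a constellation and
aligning the interference. It tolerates any `e` triples with a badly conditioned channel or with
strong noise; in all others, zero forcing and rounding recover the symbols. The spacing `4 L² + 1`
of the constellation exceeds twice the noise amplitude after zero forcing, which is at most `L`
times `2 L`. -/
theorem exists_alignmentCode (𝕜 : Type*) [RCLike 𝕜] (n L q e : ℕ) :
    ∃ (M : ℕ) (C : Code 𝕜 n fun _ _ => M), 0 < M ∧
      (∀ i m t, ‖C.enc i m t‖ ≤ 2 * ((4 * L ^ 2 + 1) * (Module.finrank ℝ 𝕜 * q))) ∧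
      ((q + 1) ^ Module.finrank ℝ 𝕜) ^ (n / 3) ≤
        M * (2 ^ (n / 3) * ((q + 1) ^ Module.finrank ℝ 𝕜) ^ (2 * e)) ∧
      ∀ (k : Fin 2) (g : Fin n → Fin 2 → 𝕜) (w : Messages fun _ _ => M) (z : Fin n → 𝕜),
        Staggered k g →
        (Finset.univ.filter fun j : Fin (n / 3) =>
            BadState L (g (slot j 0)) (g (slot j 2))).card +
          (Finset.univ.filter fun t => (L : ℝ) < ‖z t‖).card ≤ e →
        C.dec k g (C.received g w z) = w k := by
  obtain ⟨c, hcB, hcsep⟩ := exists_constellation 𝕜 q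
  obtain ⟨M, cw, D, hM, hD, hcard⟩ := exists_errorCorrectingCode (Fin (n / 3))
    (Fin (Module.finrank ℝ 𝕜) → Fin (q + 1)) e
  set a : ℝ := 4 * L ^ 2 + 1 with ha
  have ha0 : 0 < a := by positivity
  obtain ⟨f, hfm, hf⟩ := exists_measurable_rounding (fun x => a • c x) (r := a / 2) (by
    intro x y hxy
    rw [← smul_sub, norm_smul, Real.norm_of_nonneg ha0.le]
    nlinarith [hcsep x y hxy])
  refine ⟨M, ⟨fun i m => alignedWord fun k j => a • c (cw (m k) j),
    fun k g y i => D fun j => f (zeroForcing (g (slot j 0)) (g (slot j 2))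
      (firstCombination k y j) (secondCombination k y j) i), fun k => ?_⟩, hM, ?_, ?_, ?_⟩
  · refine measurable_pi_lambda _ fun i => ?_
    exact (measurable_of_finite D).comp
      (measurable_pi_lambda _ fun j => hfm.comp (measurable_zeroForcing k j i))
  · intro i m t
    refine norm_alignedWord_le (X := fun k j => a • c (cw (m k) j)) (by positivity)
      (fun k j => ?_) t
    rw [norm_smul, Real.norm_of_nonneg ha0.le]
    exact mul_le_mul_of_nonneg_left (hcB _) ha0.le
  · simpa using hcard
  · intro k g w z hg he
    funext i
    refine hD _ _ (le_trans ?_ he)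
    refine le_trans ?_ (Nat.add_le_add_left (card_noisyTriples_le z L) _)
    refine le_trans (Finset.card_le_card ?_) (Finset.card_union_le _ _)
    intro j hj
    simp only [Finset.mem_filter, Finset.mem_univ, true_and, Finset.mem_union] at hj ⊢
    by_contra hcon
    push Not at hcon
    obtain ⟨hgood, hz⟩ := hcon
    refine hj (hf _ _ ?_).symm
    have h1 := firstCombination_received hg (fun i k j => a • c (cw (w k i) j)) z j
    have h2 := secondCombination_received hg (fun i k j => a • c (cw (w k i) j)) z j
    unfold Code.received
    rw [h1, h2, zeroForcing_apply (fun h => hgood (Or.inl h))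
      (fun i => a • c (cw (w k i) j)), add_sub_cancel_left]
    have h3 := norm_zeroForcing_le hgood (norm_firstCombination_le (k := k) hz)
      (norm_secondCombination_le (k := k) hz) i
    refine lt_of_le_of_lt h3 ?_
    rw [ha]
    nlinarith

variable {Ω : Type*} {H : ℕ → Ω → Fin 2 → Fin 2 → 𝕜}

omit [RCLike 𝕜] in
theorem channelGain_slot (ω : Ω) (k : Fin 2) (j : Fin (n / 3)) (p : Fin 3) :
    channelGain H ω n k (slot j p) = H (coherenceBlock k (3 * j + p)) ω k := rfl

theorem coherenceBlock_first_second {k : Fin 2} {j : ℕ} (h : k ≠ earlyReceiver j) :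
    coherenceBlock k (3 * j) = coherenceBlock k (3 * j + 1) := by
  unfold coherenceBlock
  unfold earlyReceiver at h
  fin_cases k <;> simp at h ⊢ <;> omega

theorem coherenceBlock_second_third {k : Fin 2} {j : ℕ} (h : k = earlyReceiver j) :
    coherenceBlock k (3 * j + 1) = coherenceBlock k (3 * j + 2) := by
  unfold coherenceBlock
  unfold earlyReceiver at h
  fin_cases k <;> simp at h ⊢ <;> omega

omit [RCLike 𝕜] in
theorem staggered_channelGain (ω : Ω) (k : Fin 2) : Staggered k (channelGain H ω n k) := by
  intro j
  simp only [channelGain_slot]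
  split_ifs with h
  · exact congrArg (fun b => H b ω k) (coherenceBlock_second_third h)
  · exact congrArg (fun b => H b ω k) (coherenceBlock_first_second h)

open Classical in
/-- Distinct triples use distinct pairs of consecutive blocks, so that the badly conditioned triples
are at most as many as the badly conditioned pairs. -/
theorem card_badTriples_le (ω : Ω) (k : Fin 2) (L : ℕ) :
    ((Finset.univ.filter fun j : Fin (n / 3) => BadState L
        (channelGain H ω n k (slot j 0)) (channelGain H ω n k (slot j 2))).card : ℝ) ≤
      visits blockShift (badSequences 𝕜 L) (2 * (n / 3)) fun b => H b ω k := by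
  rw [visits_badSequences]
  norm_cast
  refine Finset.card_le_card_of_injOn (fun j => coherenceBlock k (3 * j)) ?_ ?_
  · intro j hj
    have hb : coherenceBlock k (3 * (j : ℕ) + 2) = coherenceBlock k (3 * j) + 1 := by
      unfold coherenceBlock; split_ifs <;> omega
    have hlt : coherenceBlock k (3 * (j : ℕ)) < 2 * (n / 3) := by
      unfold coherenceBlock; split_ifs <;> omega
    simp only [Finset.coe_filter, Finset.mem_univ, true_and, Set.mem_ofPred_eq, channelGain_slot,
      Fin.val_zero, Fin.val_two, Finset.mem_range, add_zero] at hj ⊢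
    rw [hb] at hj
    exact ⟨hlt, hj⟩
  · intro j _ j' _ h
    refine Fin.ext ?_
    simp only [coherenceBlock] at h
    split_ifs at h <;> omega

end Alignment

/-! ### Strong noise is rare -/

section Noise

variable (𝕜 : Type*) [RCLike 𝕜]

/-- Probability that the noise in one slot exceeds `L` in absolute value. -/
noncomputable def noiseTail (L : ℕ) : ℝ := (stdGaussian 𝕜).real {z | (L : ℝ) < ‖z‖}

theorem tendsto_noiseTail : Tendsto (noiseTail 𝕜) atTop (𝓝 0) := by
  have hanti : Antitone fun L : ℕ => {z : 𝕜 | (L : ℝ) < ‖z‖} := fun L L' hL z hz =>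
    show (L : ℝ) < ‖z‖ from lt_of_le_of_lt (Nat.cast_le.mpr hL) hz
  have hempty : ⋂ L : ℕ, {z : 𝕜 | (L : ℝ) < ‖z‖} = ∅ := by
    refine Set.eq_empty_of_forall_notMem fun z hz => ?_
    obtain ⟨L, hL⟩ := exists_nat_ge ‖z‖
    exact absurd (Set.mem_iInter.mp hz L) hL.not_gt
  have h := tendsto_measure_iInter_atTop (μ := stdGaussian 𝕜)
    (fun L : ℕ => (measurableSet_lt (measurable_const (a := (L : ℝ)))
      (measurable_norm (α := 𝕜))).nullMeasurableSet) hanti ⟨0, measure_ne_top _ _⟩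
  rw [hempty, measure_empty] at h
  exact (ENNReal.tendsto_toReal ENNReal.zero_ne_top).comp h

instance (n : ℕ) : IsProbabilityMeasure (noise 𝕜 n) := by
  unfold noise; infer_instance

open Classical in
/-- Chebyshev's inequality for the number of slots with strong noise. -/
theorem noise_real_card_gt_le (n L : ℕ) {ε : ℝ} (hε : 0 < ε) (hn : 0 < n) :
    (noise 𝕜 n).real {z | (noiseTail 𝕜 L + ε) * n <
      (Finset.univ.filter fun t => (L : ℝ) < ‖z t‖).card} ≤ 1 / (ε ^ 2 * n) := by
  have hn' : (0 : ℝ) < n := by exact_mod_cast hn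
  have hB : MeasurableSet {z : 𝕜 | (L : ℝ) < ‖z‖} :=
    measurableSet_lt measurable_const measurable_norm
  let X : 𝕜 → ℝ := {z : 𝕜 | (L : ℝ) < ‖z‖}.indicator fun _ => 1
  have hXm : Measurable X := measurable_const.indicator hB
  have hX01 : ∀ z, X z ∈ Set.Icc (0 : ℝ) 1 := fun z =>
    ⟨Set.indicator_nonneg (fun _ _ => zero_le_one) z,
      Set.indicator_le_self' (fun _ _ => zero_le_one) z⟩
  have hXL : MemLp X 2 (stdGaussian 𝕜) := by
    refine MemLp.of_bound hXm.aestronglyMeasurable 1 (ae_of_all _ fun z => ?_)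
    rw [Real.norm_of_nonneg (hX01 z).1]
    exact (hX01 z).2
  let S : (Fin n → 𝕜) → ℝ := ∑ t, fun z => X (z t)
  have hS : ∀ z, S z = (Finset.univ.filter fun t => (L : ℝ) < ‖z t‖).card := fun z => by
    simp [S, X, Set.indicator_apply, Finset.sum_boole]
  have hSL : MemLp S 2 (noise 𝕜 n) := memLp_finsetSum' _ fun t _ =>
    hXL.comp_measurePreserving (measurePreserving_eval (fun _ : Fin n => stdGaussian 𝕜) t)
  have hvar : Var[S; noise 𝕜 n] ≤ n := by
    have h1 : Var[S; noise 𝕜 n] = ∑ _t : Fin n, Var[X; stdGaussian 𝕜] :=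
      variance_sum_pi fun _ => hXL
    have h2 := variance_le_sq_of_bounded (μ := stdGaussian 𝕜) (ae_of_all _ hX01)
      hXm.aemeasurable
    rw [h1, Finset.sum_const, Finset.card_univ, Fintype.card_fin, nsmul_eq_mul]
    nlinarith
  have hmean : ∫ z, S z ∂(noise 𝕜 n) = noiseTail 𝕜 L * n := by
    have h1 : ∀ t : Fin n, ∫ z : Fin n → 𝕜, X (z t) ∂(noise 𝕜 n) = noiseTail 𝕜 L := fun t => by
      have := integral_comp_eval (μ := fun _ : Fin n => stdGaussian 𝕜) (i := t)
        (f := X) hXm.aestronglyMeasurable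
      rw [noise, this]
      simp only [X]
      rw [integral_indicator_const _ hB]
      simp [noiseTail]
    simp only [S, Finset.sum_apply]
    rw [integral_finsetSum _ fun t _ => ?_]
    · simp [h1, mul_comm]
    · exact (hXL.comp_measurePreserving (measurePreserving_eval
        (fun _ : Fin n => stdGaussian 𝕜) t)).integrable one_le_two
  have hcheb := meas_ge_le_variance_div_sq hSL (c := ε * n) (by positivity)
  rw [hmean] at hcheb
  have hreal : (noise 𝕜 n).real {z | ε * n ≤ |S z - noiseTail 𝕜 L * n|} ≤
      Var[S; noise 𝕜 n] / (ε * n) ^ 2 :=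
    ENNReal.toReal_le_of_le_ofReal (div_nonneg (variance_nonneg _ _) (by positivity)) hcheb
  calc _ ≤ (noise 𝕜 n).real {z | ε * n ≤ |S z - noiseTail 𝕜 L * n|} := by
        refine measureReal_mono fun z hz => ?_
        simp only [Set.mem_ofPred_eq] at hz ⊢
        rw [← hS] at hz
        refine le_trans ?_ (le_abs_self _)
        linarith
    _ ≤ n / (ε * n) ^ 2 := hreal.trans (by gcongr)
    _ = 1 / (ε ^ 2 * n) := by field_simp

end Noise

/-! ### Rates and degrees of freedom -/

section Rates

/-- The largest coordinate of the constellation points at power `P`. Constellation points have `d`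
real coordinates and are spaced by `4 ⌊log P⌋² + 1`. -/
noncomputable def constellationSize (d : ℕ) (P : ℝ) : ℕ :=
  ⌊√P / (2 * ((4 * (⌊Real.log P⌋₊ : ℝ) ^ 2 + 1) * d))⌋₊

theorem constellationSize_mul_le {d : ℕ} (hd : 0 < d) (P : ℝ) :
    2 * ((4 * (⌊Real.log P⌋₊ : ℝ) ^ 2 + 1) * (d * constellationSize d P)) ≤ √P := by
  have hd' : (0 : ℝ) < d := by exact_mod_cast hd
  have hpos : 0 < 2 * ((4 * (⌊Real.log P⌋₊ : ℝ) ^ 2 + 1) * d) := by positivity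
  have h := Nat.floor_le (div_nonneg (Real.sqrt_nonneg P) hpos.le)
  rw [le_div_iff₀ hpos] at h
  unfold constellationSize
  linarith

/-- The logarithm of the constellation spacing is negligible compared to `log P`. -/
theorem tendsto_log_constellationSize {d : ℕ} (hd : 0 < d) :
    Tendsto (fun P => Real.log (constellationSize d P + 1) / Real.log P) atTop (𝓝 (1 / 2)) := by
  have hd1 : (1 : ℝ) ≤ d := by exact_mod_cast hd
  have hx := Real.tendsto_log_atTop
  have hconst : ∀ C : ℝ, Tendsto (fun P => C / Real.log P) atTop (𝓝 0) := fun C =>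
    tendsto_const_nhds.div_atTop hx
  have hloglog : Tendsto (fun P => Real.log (Real.log P) / Real.log P) atTop (𝓝 0) := by
    have h := Real.tendsto_pow_log_div_mul_add_atTop 1 0 1 one_ne_zero
    simp only [pow_one, one_mul, add_zero] at h
    exact h.comp hx
  have hlow : Tendsto (fun P => 1 / 2 - (Real.log (10 * d) / Real.log P +
      2 * (Real.log (Real.log P) / Real.log P))) atTop (𝓝 (1 / 2)) := by
    simpa only [mul_zero, add_zero, sub_zero] using
      ((hconst (Real.log (10 * d))).add (hloglog.const_mul 2)).const_sub (1 / 2)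
  have hup : Tendsto (fun P => 1 / 2 + Real.log 2 / Real.log P) atTop (𝓝 (1 / 2)) := by
    simpa only [add_zero] using (hconst (Real.log 2)).const_add (1 / 2)
  refine tendsto_of_tendsto_of_tendsto_of_le_of_le' hlow hup ?_ ?_
  · filter_upwards [hx.eventually_ge_atTop 1, eventually_ge_atTop 1] with P hlog hP
    have hx0 : 0 < Real.log P := by linarith
    have hfl : (⌊Real.log P⌋₊ : ℝ) ≤ Real.log P := Nat.floor_le hx0.le
    have hsq : 0 < √P := Real.sqrt_pos.mpr (by linarith)
    have hden : 2 * ((4 * (⌊Real.log P⌋₊ : ℝ) ^ 2 + 1) * d) ≤ 10 * d * Real.log P ^ 2 := by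
      have h1 : (⌊Real.log P⌋₊ : ℝ) ^ 2 ≤ Real.log P ^ 2 := by gcongr
      have h2 : 1 ≤ Real.log P ^ 2 := one_le_pow₀ hlog
      nlinarith
    have hq : √P / (10 * d * Real.log P ^ 2) ≤ constellationSize d P + 1 := by
      refine le_trans ?_ (Nat.lt_floor_add_one _).le
      gcongr
    have hlogq := Real.log_le_log (by positivity) hq
    rw [Real.log_div hsq.ne' (by positivity), Real.log_sqrt (by linarith),
      Real.log_mul (by positivity) (by positivity), Real.log_pow] at hlogq
    rw [le_div_iff₀ hx0]
    field_simp
    push_cast at hlogq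
    linarith
  · filter_upwards [hx.eventually_ge_atTop 1, eventually_ge_atTop 1] with P hlog hP
    have hx0 : 0 < Real.log P := by linarith
    have hsq : 1 ≤ √P := Real.one_le_sqrt.mpr hP
    have hq : (constellationSize d P : ℝ) + 1 ≤ 2 * √P := by
      have h1 := constellationSize_mul_le hd P
      have h2 : (0 : ℝ) ≤ constellationSize d P := Nat.cast_nonneg _
      have h3 : (1 : ℝ) * (1 * constellationSize d P) ≤
          2 * ((4 * (⌊Real.log P⌋₊ : ℝ) ^ 2 + 1) * (d * constellationSize d P)) := by
        have h4 : 1 * (1 * (constellationSize d P : ℝ)) ≤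
            (4 * (⌊Real.log P⌋₊ : ℝ) ^ 2 + 1) * (d * constellationSize d P) := by
          gcongr
          nlinarith [sq_nonneg (⌊Real.log P⌋₊ : ℝ)]
        linarith
      linarith
    have hlogq := Real.log_le_log (by positivity) hq
    rw [Real.log_mul (by norm_num) (by positivity), Real.log_sqrt (by linarith)] at hlogq
    rw [div_le_iff₀ hx0]
    field_simp
    linarith

/-- The logarithmic form of the Gilbert–Varshamov bound for words of length `n / 3` that tolerate
`η * n` errors. The final `- 1` absorbs the at most two slots left over by the division by `3`. -/
theorem mul_rate_le_log {M n Q e : ℕ} {η : ℝ} (hM : 0 < M) (hQ : 0 < Q) 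
    (he : e ≤ η * n) (hcard : Q ^ (n / 3) ≤ M * (2 ^ (n / 3) * Q ^ (2 * e)))
    (hn : Real.log Q ≤ n) :
    n * ((1 / 3 - 2 * η) * Real.log Q - Real.log 2 - 1) ≤ Real.log M := by
  have hQ' : (0 : ℝ) < Q := by exact_mod_cast hQ
  have hM' : (0 : ℝ) < M := by exact_mod_cast hM
  have hlQ : 0 ≤ Real.log Q := Real.log_natCast_nonneg Q
  have hl2 : 0 ≤ Real.log 2 := Real.log_nonneg one_le_two
  have hcard' : (Q : ℝ) ^ (n / 3) ≤ M * (2 ^ (n / 3) * Q ^ (2 * e)) := by exact_mod_cast hcard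
  have h := Real.log_le_log (by positivity) hcard'
  rw [Real.log_mul hM'.ne' (by positivity), Real.log_mul (by positivity) (by positivity),
    Real.log_pow, Real.log_pow, Real.log_pow] at h
  have h3 : ((n / 3 : ℕ) : ℝ) ≤ n := by exact_mod_cast Nat.div_le_self n 3
  have h4 : (n : ℝ) ≤ 3 * ((n / 3 : ℕ) : ℝ) + 3 := by
    have : n ≤ 3 * (n / 3) + 3 := by omega
    exact_mod_cast this
  push_cast at h
  nlinarith [mul_le_mul_of_nonneg_right he hlQ, mul_le_mul_of_nonneg_right h3 hl2,
    mul_le_mul_of_nonneg_right h4 hlQ]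

end Rates

/-! ### The code family -/

section Family

variable {𝕜 : Type*} [RCLike 𝕜]

open Classical in
/-- If all messages are decoded correctly unless the noise is strong in too many slots, the error
probability obeys the bound of Chebyshev's inequality. -/
theorem errorProb_le {n L : ℕ} {M : Fin 2 → Fin 2 → ℕ} (C : Code 𝕜 n M) (k : Fin 2)
    (g : Fin n → Fin 2 → 𝕜) {ε : ℝ} (hε : 0 < ε) (hn : 0 < n)
    (h : ∀ w z, ((Finset.univ.filter fun t => (L : ℝ) < ‖z t‖).card : ℝ) ≤
      (noiseTail 𝕜 L + ε) * n → C.dec k g (C.received g w z) = w k) :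
    C.errorProb k g ≤ 1 / (ε ^ 2 * n) := by
  have hw : ∀ w, (noise 𝕜 n).real {z | C.dec k g (C.received g w z) ≠ w k} ≤
      1 / (ε ^ 2 * n) := fun w => by
    refine le_trans (measureReal_mono fun z hz => ?_) (noise_real_card_gt_le 𝕜 n L hε hn)
    by_contra hle
    exact hz (h w z (not_lt.mp hle))
  unfold Code.errorProb
  refine div_le_of_le_mul₀ (Nat.cast_nonneg _) (by positivity) ?_
  refine (Finset.sum_le_sum fun w _ => hw w).trans ?_
  simp [mul_comm]

theorem errorProb_nonneg {n : ℕ} {M : Fin 2 → Fin 2 → ℕ} (C : Code 𝕜 n M) (k : Fin 2)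
    (g : Fin n → Fin 2 → 𝕜) : 0 ≤ C.errorProb k g :=
  div_nonneg (Finset.sum_nonneg fun _ _ => measureReal_nonneg) (Nat.cast_nonneg _)

/-- Codes that carry `1 / 3` degree of freedom per message and that are reliable at power `P`
whenever badly conditioned channel states, at the level `⌊log P⌋`, have frequency at most `δ`. -/
theorem exists_codeFamily (𝕜 : Type*) [RCLike 𝕜] {δ : ℕ → ℝ} (hδ0 : ∀ L, 0 ≤ δ L)
    (hδ : Tendsto δ atTop (𝓝 0)) {Ω : Type*} (H : ℕ → Ω → Fin 2 → Fin 2 → 𝕜) :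
    ∃ S : CodeFamily 𝕜, S.PowerConstrained ∧ S.HasDoF (fun _ _ => 1 / 3) ∧
      ∀ ω P, (∀ k, RarelyBad H ω k ⌊Real.log P⌋₊ (δ ⌊Real.log P⌋₊)) → S.Reliable H ω P := by
  set d := Module.finrank ℝ 𝕜 with hd
  have hd0 : 0 < d := Module.finrank_pos
  have hd' : (0 : ℝ) < d := by exact_mod_cast hd0
  set η : ℕ → ℝ := fun L => δ L + (noiseTail 𝕜 L + 1 / (L + 1)) with hη
  have hη0 : ∀ L, 0 ≤ η L := fun L =>
    add_nonneg (hδ0 L) (add_nonneg measureReal_nonneg (by positivity))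
  have hηlim : Tendsto η atTop (𝓝 0) := by
    simpa [hη] using hδ.add ((tendsto_noiseTail 𝕜).add tendsto_one_div_add_atTop_nhds_zero_nat)
  choose M C hM hnorm hcard hdec using fun (P : ℝ) (n : ℕ) =>
    exists_alignmentCode 𝕜 n ⌊Real.log P⌋₊ (constellationSize d P) ⌊η ⌊Real.log P⌋₊ * n⌋₊
  refine ⟨⟨fun P n _ _ => M P n, C⟩, ?_, ?_, ?_⟩
  · intro P hP n i m
    refine (Finset.sum_le_sum fun t _ => ?_).trans (b := ∑ _t : Fin n, P) ?_
    · have h := (hnorm P n i m t).trans (constellationSize_mul_le hd0 P)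
      calc _ ≤ √P ^ 2 := by gcongr
        _ = P := Real.sq_sqrt hP.le
    · simp
  · refine ⟨fun P _ _ => (1 / 3 - 2 * η ⌊Real.log P⌋₊) *
      Real.log (((constellationSize d P + 1) ^ d : ℕ)) - Real.log 2 - 1, ?_, fun _ _ => ?_⟩
    · intro P _ _ _
      have hlarge := tendsto_natCast_atTop_atTop (R := ℝ) |>.eventually_ge_atTop
        (Real.log (((constellationSize d P + 1) ^ d : ℕ)))
      filter_upwards [hlarge] with n hn
      exact mul_rate_le_log (hM P n) (by positivity)
        (Nat.floor_le (mul_nonneg (hη0 _) n.cast_nonneg)) (hcard P n) hn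
    · have hlevel : Tendsto (fun P => ⌊Real.log P⌋₊) atTop atTop :=
        tendsto_nat_floor_atTop.comp Real.tendsto_log_atTop
      have h1 : Tendsto (fun P => (1 / 3 - 2 * η ⌊Real.log P⌋₊) *
          (2 * (Real.log (constellationSize d P + 1) / Real.log P)) -
          ((Real.log 2 + 1) / (d / 2)) / Real.log P) atTop
          (𝓝 ((1 / 3 - 2 * 0) * (2 * (1 / 2)) - 0)) :=
        ((((hηlim.comp hlevel).const_mul 2).const_sub (1 / 3)).mul
          ((tendsto_log_constellationSize hd0).const_mul 2)).sub
          (tendsto_const_nhds.div_atTop Real.tendsto_log_atTop)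
      have h2 : (1 / 3 - 2 * 0) * (2 * (1 / 2)) - 0 = (1 / 3 : ℝ) := by norm_num
      rw [h2] at h1
      refine h1.congr' ?_
      filter_upwards [Real.tendsto_log_atTop.eventually_gt_atTop 0] with P hP
      rw [← hd]
      push_cast
      rw [Real.log_pow]
      field_simp
      ring
  · intro ω P hω k
    set L := ⌊Real.log P⌋₊ with hL
    set ε : ℝ := 1 / (L + 1) with hε
    have hε0 : 0 < ε := by positivity
    have hlim : Tendsto (fun n : ℕ => 1 / (ε ^ 2 * (n : ℝ))) atTop (𝓝 0) :=
      tendsto_const_nhds.div_atTop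
        (tendsto_natCast_atTop_atTop.const_mul_atTop (by positivity))
    refine squeeze_zero' (Eventually.of_forall fun n => errorProb_nonneg _ _ _) ?_ hlim
    -- The first `n / 3` triples involve only the first `2 * (n / 3)` pairs of consecutive blocks.
    have htriple : Tendsto (fun n : ℕ => 2 * (n / 3)) atTop atTop :=
      tendsto_atTop.mpr fun b => by
        filter_upwards [eventually_ge_atTop (3 * b)] with n hn
        omega
    filter_upwards [htriple.eventually (hω k), eventually_gt_atTop 0] with n hn hn0
    refine errorProb_le (L := L) _ k _ hε0 hn0 fun w z hz => ?_
    refine hdec P n k _ w z (staggered_channelGain ω k) (Nat.le_floor ?_)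
    have h1 := (card_badTriples_le (H := H) (n := n) ω k L).trans hn
    have h2 : ((2 * (n / 3) : ℕ) : ℝ) ≤ n := by
      have : 2 * (n / 3) ≤ n := by omega
      exact_mod_cast this
    have h3 := mul_le_mul_of_nonneg_left h2 (hδ0 L)
    have h4 : η L * n = δ L * n + (noiseTail 𝕜 L + ε) * n := by rw [hη]; ring
    rw [h4]
    push_cast at h1 h3 ⊢
    linarith

end Family

end XChannel

theorem theorem3 {𝕜 Ω : Type*} [RCLike 𝕜] [MeasurableSpace Ω]
    (μ : Measure Ω) [IsProbabilityMeasure μ]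
    (H : ℕ → Ω → Fin 2 → Fin 2 → 𝕜) (hmeas : ∀ b, Measurable (H b))
    (hstat : XChannel.StationaryFading μ H) (hgen : XChannel.GenericFading μ H) :
    XChannel.AchievesTotalDoF μ H (4 / 3) ∧
      (XChannel.ErgodicFading μ H → XChannel.AchievesErgodicTotalDoF μ H (4 / 3)) := by
  have hlevel : Tendsto (fun P => ⌊Real.log P⌋₊) atTop atTop :=
    tendsto_nat_floor_atTop.comp Real.tendsto_log_atTop
  have hsum : ∑ _k : Fin 2, ∑ _i : Fin 2, (1 / 3 : ℝ) = 4 / 3 := by norm_num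
  constructor
  · obtain ⟨δ, hδ, hae⟩ := XChannel.exists_ae_eventually_rarelyBad hmeas hstat hgen
    obtain ⟨S, hpow, hdof, hrel⟩ := XChannel.exists_codeFamily 𝕜 (fun L => abs_nonneg (δ L))
      (by simpa using hδ.abs) H
    refine ⟨fun _ _ => 1 / 3, fun _ _ => by norm_num, hsum, S, hpow, hdof, ?_⟩
    filter_upwards [hae] with ω hω
    filter_upwards [hlevel.eventually hω] with P hP
    exact hrel ω P fun k => (hP k).mono (le_abs_self _)
  · intro herg
    obtain ⟨δ, hδ, hae⟩ := XChannel.exists_ae_rarelyBad_of_ergodic hmeas hgen herg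
    obtain ⟨S, hpow, hdof, hrel⟩ := XChannel.exists_codeFamily 𝕜 (fun L => abs_nonneg (δ L))
      (by simpa using hδ.abs) H
    refine ⟨fun _ _ => 1 / 3, fun _ _ => by norm_num, hsum, S, hpow, hdof, fun P _ => ?_⟩
    filter_upwards [hae ⌊Real.log P⌋₊] with ω hω
    exact hrel ω P fun k => (hω k).mono (le_abs_self _)
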